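/- Let $V\in C^2(\mathbb{R}^n,\mathbb{R})$ with $\sup_{q\in\mathbb{R}^n}|V''(q)|=C<\infty$ (operator norm), let $T>0$, $q_0,q_T\in\mathbb{R}^n$, and let $\mathcal{H}=H^1_0([0,T],\mathbb{R}^n)$ be the Hilbert space with inner product $\langle c,d\rangle=\int_0^T\dot c(t)\cdot\dot d(t)\,dt$. For $c\in\mathcal{H}$ put $\iota(c)(t)=q_0+\frac{t}{T}(q_T-q_0)+c(t)$ and $$L(c)=\int_0^T\Big(\tfrac12\big|\tfrac{d}{dt}\iota(c)(t)\big|^2-V(\iota(c)(t))\Big)dt .$$ For a natural number $N\ge\lfloor T\sqrt{C}/\pi\rfloor$ let $\mathcal{U}_N$ be the span of the functions $\varphi_k^j$ ($1\le k\le N$, $1\le j\le n$) whose $j$-th component is $\sqrt{2/T}\,\sin(k\pi t/T)$ and whose other components vanish, let $\mathcal{V}_N$ be its orthogonal complement in $\mathcal{H}$, and let $\mathbb{P}_N,\mathbb{Q}_N$ be the orthogonal projectors onto $\mathcal{U}_N,\mathcal{V}_N$. Gradients and Hessians are taken with respect to the inner product of $\mathcal{H}$; write $\partial_{\mathcal{U}_N}L=\mathbb{P}_N\nabla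 L$, $\partial_{\mathcal{V}_N}L=\mathbb{Q}_N\nabla L$ and, for the blocks of the operator $d^2L(c)$ on $\mathcal{H}=\mathcal{U}_N\oplus\mathcal{V}_N$, $$\partial_{\mathcal{U}_N}^2L=\mathbb{P}_N\,d^2L\,\mathbb{P}_N,\quad \partial_{\mathcal{U}_N}\partial_{\mathcal{V}_N}L=\mathbb{Q}_N\,d^2L\,\mathbb{P}_N,\quad \partial_{\mathcal{V}_N}\partial_{\mathcal{U}_N}L=\mathbb{P}_N\,d^2L\,\mathbb{Q}_N,\quad \partial_{\mathcal{V}_N}^2L=\mathbb{Q}_N\,d^2L\,\mathbb{Q}_N .$$ Then $L$ is twice continuously Fréchet differentiable, and there is a (necessarily unique) map $\tilde v:\mathcal{U}_N\to\mathcal{V}_N$ such that, for all $u\in\mathcal{U}_N$ and $v\in\mathcal{V}_N$, $\mathbb{Q}_N\nabla L(u+v)=0$ if and only if $v=\tilde v(u)$. The map $\tilde v$ is continuously differentiable, and the reduced functional $S:\mathcal{U}_N\to\mathbb{R}$, $S(u)=L(u+\tilde v(u))$, is twice continuously differentiable. For every $u\in\mathcal{U}_N$, with $c=u+\tilde v(u)$,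 the operator $\partial_{\mathcal{V}_N}^2L(c)$ on $\mathcal{V}_N$ is invertible with bounded inverse, and $$dS(u)=\partial_{\mathcal{U}_N}L(c),\qquad \frac{\partial\tilde v}{\partial u}(u)=-\big[\partial_{\mathcal{V}_N}^2L(c)\big]^{-1}\cdot\partial_{\mathcal{U}_N}\partial_{\mathcal{V}_N}L(c),$$ $$d^2S(u)=\partial_{\mathcal{U}_N}^2L(c)-\partial_{\mathcal{V}_N}\partial_{\mathcal{U}_N}L(c)\cdot\big[\partial_{\mathcal{V}_N}^2L(c)\big]^{-1}\cdot\partial_{\mathcal{U}_N}\partial_{\mathcal{V}_N}L(c).$$ -/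

import Mathlib

noncomputable section

open MeasureTheory Set
open scoped Gradient

namespace ExactReduction

/-- The configuration space `ℝⁿ` with its Euclidean norm. -/
abbrev Conf (n : ℕ) : Type := EuclideanSpace ℝ (Fin n)

/-- The space `L²((0,T), ℝⁿ)`. -/
abbrev L2 (T : ℝ) (n : ℕ) : Type := Lp (Conf n) 2 (volume.restrict (Ioc 0 T))

theorem L2.intervalIntegrable {T : ℝ} {n : ℕ} (g : L2 T n) {s t : ℝ}
    (hs : s ∈ Icc 0 T) (ht : t ∈ Icc 0 T) : IntervalIntegrable g volume s t := by
  have h : IntegrableOn g (Ioc 0 T) volume :=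
    (Lp.memLp g).integrable (by norm_num)
  rw [intervalIntegrable_iff]
  refine h.mono_set ?_
  intro x hx
  rcases le_total s t with hst | hst
  · rw [uIoc_of_le hst] at hx
    exact ⟨hs.1.trans_lt hx.1, hx.2.trans ht.2⟩
  · rw [uIoc_of_ge hst] at hx
    exact ⟨ht.1.trans_lt hx.1, hx.2.trans hs.2⟩

theorem intervalIntegral_congr_L2 {T : ℝ} {n : ℕ} {f g : ℝ → Conf n}
    (h : f =ᵐ[volume.restrict (Ioc 0 T)] g) {s t : ℝ}
    (hs : s ∈ Icc 0 T) (ht : t ∈ Icc 0 T) : ∫ x in s..t, f x = ∫ x in s..t, g x := by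
  have h' := (ae_restrict_iff' measurableSet_Ioc).1 h
  refine intervalIntegral.integral_congr_ae ?_
  filter_upwards [h'] with x hx hxs
  apply hx
  rcases le_total s t with hst | hst
  · rw [uIoc_of_le hst] at hxs
    exact ⟨hs.1.trans_lt hxs.1, hxs.2.trans ht.2⟩
  · rw [uIoc_of_ge hst] at hxs
    exact ⟨ht.1.trans_lt hxs.1, hxs.2.trans hs.2⟩

/-- The pairs `(c, g)` where `c` is an `H¹` curve on `[0,T]` (an absolutely continuous curve with
square integrable derivative), `g ∈ L²` is its derivative, and `c(0) = c(T) = 0`; the curve is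
extended by zero outside `[0,T]`. Such a `g` is uniquely determined by `c`. -/
def H10Sub (T : ℝ) (n : ℕ) : Submodule ℝ ((ℝ → Conf n) × L2 T n) where
  carrier := {p | (∀ s ∈ Icc 0 T, ∀ t ∈ Icc 0 T, p.1 t - p.1 s = ∫ x in s..t, p.2 x) ∧
    ∀ t, t ∉ Ioo 0 T → p.1 t = 0}
  add_mem' := by
    rintro p q ⟨hp, hp0⟩ ⟨hq, hq0⟩
    refine ⟨fun s hs t ht => ?_, fun t ht => by simp [hp0 t ht, hq0 t ht]⟩
    have h1 : ∫ x in s..t, (p + q).2 x = ∫ x in s..t, (p.2 x + q.2 x) :=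
      intervalIntegral_congr_L2 (Lp.coeFn_add p.2 q.2) hs ht
    rw [h1, intervalIntegral.integral_add (p.2.intervalIntegrable hs ht)
      (q.2.intervalIntegrable hs ht), ← hp s hs t ht, ← hq s hs t ht]
    simp only [Prod.fst_add, Pi.add_apply]
    abel
  zero_mem' := by
    refine ⟨fun s hs t ht => ?_, fun t _ => rfl⟩
    have h1 : ∫ x in s..t, (0 : (ℝ → Conf n) × L2 T n).2 x = ∫ x in s..t, (0 : Conf n) :=
      intervalIntegral_congr_L2 (Lp.coeFn_zero (Conf n) 2 (volume.restrict (Ioc 0 T))) hs ht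
    rw [h1]
    simp
  smul_mem' := by
    rintro a p ⟨hp, hp0⟩
    refine ⟨fun s hs t ht => ?_, fun t ht => by simp [hp0 t ht]⟩
    have h1 : ∫ x in s..t, (a • p).2 x = ∫ x in s..t, a • p.2 x :=
      intervalIntegral_congr_L2 (Lp.coeFn_smul a p.2) hs ht
    rw [h1, intervalIntegral.integral_smul, ← hp s hs t ht]
    simp [smul_sub]

/-- The Sobolev space `H¹₀([0,T], ℝⁿ)`. -/
def H10 (T : ℝ) (n : ℕ) : Type := H10Sub T n

namespace H10

variable {T : ℝ} {n : ℕ}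

instance : AddCommGroup (H10 T n) := inferInstanceAs (AddCommGroup (H10Sub T n))

instance : Module ℝ (H10 T n) := inferInstanceAs (Module ℝ (H10Sub T n))

/-- The underlying curve `t ↦ c(t)`. -/
def curve (c : H10 T n) : ℝ → Conf n := c.1.1

/-- The derivative `ċ ∈ L²` of the curve. -/
def velocity : H10 T n →ₗ[ℝ] L2 T n :=
  (LinearMap.snd ℝ (ℝ → Conf n) (L2 T n)).comp (H10Sub T n).subtype

theorem velocity_injective : Function.Injective (velocity : H10 T n →ₗ[ℝ] L2 T n) := by
  intro c d h
  have hv : c.1.2 = d.1.2 := h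
  refine Subtype.ext (Prod.ext (funext fun t => ?_) hv)
  by_cases ht : t ∈ Ioo 0 T
  · have h0 : (0 : ℝ) ∈ Icc 0 T := ⟨le_rfl, (ht.1.trans ht.2).le⟩
    have h1 := c.2.1 0 h0 t (Ioo_subset_Icc_self ht)
    have h2 := d.2.1 0 h0 t (Ioo_subset_Icc_self ht)
    rw [c.2.2 0 (by simp), sub_zero] at h1
    rw [d.2.2 0 (by simp), sub_zero] at h2
    rw [h1, h2, hv]
  · rw [c.2.2 t ht, d.2.2 t ht]

/-- The norm `‖c‖² = ∫₀ᵀ |ċ|² dt`. -/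
instance : NormedAddCommGroup (H10 T n) :=
  NormedAddCommGroup.induced (H10 T n) (L2 T n) velocity velocity_injective

/-- The inner product `⟨c, d⟩ = ∫₀ᵀ ċ · ḋ dt`. -/
instance : InnerProductSpace ℝ (H10 T n) where
  norm_smul_le a c := by
    change ‖velocity (a • c)‖ ≤ ‖a‖ * ‖velocity c‖
    rw [map_smul, norm_smul]
  inner c d := inner ℝ (velocity c) (velocity d)
  norm_sq_eq_re_inner c := norm_sq_eq_re_inner (𝕜 := ℝ) (velocity c)
  conj_inner_symm c d := inner_conj_symm (𝕜 := ℝ) (velocity c) (velocity d)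
  add_left c d e := by
    change inner ℝ (velocity (c + d)) (velocity e) = _
    rw [map_add, inner_add_left]
  smul_left c d a := by
    change inner ℝ (velocity (a • c)) (velocity d) = _
    rw [map_smul, inner_smul_left]

theorem isometry_velocity : Isometry (velocity : H10 T n →ₗ[ℝ] L2 T n) :=
  AddMonoidHomClass.isometry_of_norm _ fun _ => rfl

theorem range_velocity : range (velocity : H10 T n →ₗ[ℝ] L2 T n) =
    {g : L2 T n | ∫ x in Ioc 0 T, g x = 0} := by
  ext g
  constructor
  · rintro ⟨c, rfl⟩
    change ∫ x in Ioc 0 T, c.1.2 x = 0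
    rcases le_or_gt 0 T with hT | hT
    · have h := c.2.1 0 ⟨le_rfl, hT⟩ T ⟨hT, le_rfl⟩
      rw [c.2.2 0 (by simp), c.2.2 T (by simp), sub_zero,
        intervalIntegral.integral_of_le hT] at h
      exact h.symm
    · simp [Ioc_eq_empty_of_le hT.le]
  · intro hg
    change ∫ x in Ioc 0 T, g x = 0 at hg
    have hz : ∀ t ∈ Icc 0 T, t ∉ Ioo 0 T → ∫ x in (0 : ℝ)..t, g x = 0 := by
      intro t ht ht'
      rcases ht.1.eq_or_lt with h0 | h0
      · rw [← h0, intervalIntegral.integral_same]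
      · have htT : t = T := by
          by_contra hne
          exact ht' ⟨h0, lt_of_le_of_ne ht.2 hne⟩
        rw [htT, intervalIntegral.integral_of_le (htT ▸ ht.1), hg]
    refine ⟨⟨((Icc 0 T).indicator fun t => ∫ x in (0 : ℝ)..t, g x, g), ?_, ?_⟩, rfl⟩
    · intro s hs t ht
      have h0 : (0 : ℝ) ∈ Icc 0 T := ⟨le_rfl, hs.1.trans hs.2⟩
      dsimp only
      rw [indicator_of_mem ht, indicator_of_mem hs]
      exact intervalIntegral.integral_interval_sub_left (g.intervalIntegrable h0 ht)
        (g.intervalIntegrable h0 hs)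
    · intro t ht
      dsimp only
      by_cases h : t ∈ Icc 0 T
      · rw [indicator_of_mem h, hz t h ht]
      · rw [indicator_of_notMem h]

instance : CompleteSpace (H10 T n) := by
  rw [completeSpace_iff_isComplete_range isometry_velocity.isUniformInducing, range_velocity]
  have hset : {g : L2 T n | ∫ x in Ioc 0 T, g x = 0} = ⋂ e : Conf n,
      {g : L2 T n | inner ℝ (indicatorConstLp 2 MeasurableSet.univ
        (measure_ne_top (volume.restrict (Ioc 0 T)) univ) e) g = 0} := by
    ext g
    simp only [mem_ofPred_eq, mem_iInter, L2.inner_indicatorConstLp_eq_inner_setIntegral,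
      Measure.restrict_univ]
    exact ⟨fun h e => by rw [h, inner_zero_right], fun h => inner_self_eq_zero.1 (h _)⟩
  rw [hset]
  exact IsClosed.isComplete (isClosed_iInter fun e =>
    isClosed_eq (continuous_const.inner continuous_id) continuous_const)

end H10

variable {n : ℕ}

/-- The mechanical Lagrangian `ℒ(q, q̇) = ½ |q̇|² - V(q)`. -/
def lagrangian (V : Conf n → ℝ) (q q' : Conf n) : ℝ := 1 / 2 * ‖q'‖ ^ 2 - V q

/-- The action `∫₀ᵀ ℒ(γ, γ̇) dt` of a curve `γ` with derivative `γ'`. -/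
def curveAction (V : Conf n → ℝ) (T : ℝ) (γ γ' : ℝ → Conf n) : ℝ :=
  ∫ t in (0 : ℝ)..T, lagrangian V (γ t) (γ' t)

/-- The curve `ι(c)(t) = q₀ + (t/T) (q_T - q₀) + c(t)` from `q₀` to `q_T`. -/
def iota {T : ℝ} (q₀ qT : Conf n) (c : H10 T n) (t : ℝ) : Conf n :=
  q₀ + (t / T) • (qT - q₀) + c.curve t

/-- The derivative `(q_T - q₀)/T + ċ(t)` of `ι(c)`. -/
def iotaVelocity {T : ℝ} (q₀ qT : Conf n) (c : H10 T n) (t : ℝ) : Conf n :=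
  (1 / T) • (qT - q₀) + H10.velocity c t

/-- The action functional `L` on `H¹₀([0,T], ℝⁿ)`. -/
def action (V : Conf n → ℝ) {T : ℝ} (q₀ qT : Conf n) (c : H10 T n) : ℝ :=
  curveAction V T (iota q₀ qT c) (iotaVelocity q₀ qT c)

theorem memLp_cos (T a b : ℝ) (e : Conf n) :
    MemLp (fun t : ℝ => (a * (b * Real.cos (b * t))) • e) 2 (volume.restrict (Ioc 0 T)) := by
  refine MemLp.of_bound (C := |a| * |b| * ‖e‖) ?_ (Filter.Eventually.of_forall fun t => ?_)
  · exact Continuous.aestronglyMeasurable (by fun_prop)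
  · rw [norm_smul, Real.norm_eq_abs, abs_mul, abs_mul]
    have := Real.abs_cos_le_one (b * t)
    gcongr
    nlinarith [abs_nonneg b]

/-- The element `φₖʲ` of `H¹₀`: its `j`-th component is `√(2/T) sin(k π t / T)`, the other
components vanish. -/
def sineMode (T : ℝ) (k : ℕ) (j : Fin n) : H10 T n :=
  ⟨((Icc 0 T).indicator fun t =>
      (√(2 / T) * Real.sin (k * Real.pi / T * t)) • EuclideanSpace.single j (1 : ℝ),
    (memLp_cos T √(2 / T) (k * Real.pi / T) (EuclideanSpace.single j (1 : ℝ))).toLp _), by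
  constructor
  · intro s hs t ht
    dsimp only
    rw [indicator_of_mem ht, indicator_of_mem hs,
      intervalIntegral_congr_L2 (MemLp.coeFn_toLp _) hs ht]
    refine (intervalIntegral.integral_eq_sub_of_hasDerivAt
      (f := fun t : ℝ => (√(2 / T) * Real.sin (k * Real.pi / T * t)) •
        EuclideanSpace.single j (1 : ℝ)) (fun x _ => ?_) ?_).symm
    · have h := (((hasDerivAt_id x).const_mul (k * Real.pi / T)).sin.const_mul
        √(2 / T)).smul_const (EuclideanSpace.single j (1 : ℝ))
      simpa [mul_comm, mul_left_comm, mul_assoc] using h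
    · exact Continuous.intervalIntegrable (by fun_prop) _ _
  · intro t ht
    dsimp only
    by_cases h : t ∈ Icc 0 T
    · rw [indicator_of_mem h]
      rcases h.1.eq_or_lt with h0 | h0
      · simp [← h0]
      · have htT : t = T := by
          by_contra hne
          exact ht ⟨h0, lt_of_le_of_ne h.2 hne⟩
        have hT : T ≠ 0 := by
          rw [← htT]
          exact h0.ne'
        rw [htT, div_mul_cancel₀ _ hT, Real.sin_nat_mul_pi]
        simp
    · rw [indicator_of_notMem h]⟩

/-- The space `𝒰_N`, spanned by the `φₖʲ` with `1 ≤ k ≤ N`. -/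
def lowModes (T : ℝ) (n N : ℕ) : Submodule ℝ (H10 T n) :=
  Submodule.span ℝ (range fun p : Fin N × Fin n => sineMode T ((p.1 : ℕ) + 1) p.2)

instance (T : ℝ) (n N : ℕ) : FiniteDimensional ℝ (lowModes T n N) :=
  FiniteDimensional.span_of_finite ℝ (finite_range _)

/-- The space `𝒱_N`, the orthogonal complement of `𝒰_N`. -/
abbrev highModes (T : ℝ) (n N : ℕ) : Submodule ℝ (H10 T n) := (lowModes T n N)ᗮ

section Hilbert

variable {E : Type*} [NormedAddCommGroup E] [InnerProductSpace ℝ E] [CompleteSpace E]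

/-- The Hessian `d²f(x)`, as a linear operator on the Hilbert space: the derivative of `∇f`. -/
def hessian (f : E → ℝ) (x : E) : E →L[ℝ] E := fderiv ℝ (∇ f) x

/-- The component `P_W ∇f(x)` of the gradient, that is, `∂_W f(x)`. -/
def partialGradient (W : Submodule ℝ E) [W.HasOrthogonalProjection] (f : E → ℝ) (x : E) : W :=
  W.orthogonalProjectionOnto (∇ f x)

/-- The block `P_{W'} d²f(x) P_W` of the Hessian as an operator `W → W'`, that is,
`∂_W ∂_{W'} f(x)`. -/
def hessianBlock (W W' : Submodule ℝ E) [W'.HasOrthogonalProjection] (f : E → ℝ) (x : E) :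
    W →L[ℝ] W' :=
  W'.orthogonalProjectionOnto ∘L hessian f x ∘L W.subtypeL

end Hilbert

/-- The reduced functional `S(u) = L(u + ṽ(u))` of a map `ṽ : 𝒰_N → 𝒱_N`. -/
def reducedAction (V : Conf n → ℝ) {T : ℝ} (q₀ qT : Conf n) {N : ℕ}
    (v : lowModes T n N → highModes T n N) (u : lowModes T n N) : ℝ :=
  action V q₀ qT ((u : H10 T n) + (v u : H10 T n))

end ExactReduction

end

open ExactReduction

noncomputable section

open MeasureTheory Set
open scoped Gradient

namespace ExactReduction

/-! ### Lyapunov–Schmidt reduction in a Hilbert space. -/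

section Reduction

variable {E : Type*} [NormedAddCommGroup E] [InnerProductSpace ℝ E] [CompleteSpace E]

/-! In the inner product of `H10` the kinetic term has Hessian equal to the identity, so d²L(c) = Id
- K(c), where ⟨K(c)h, k⟩ is the integral of V''(ι(c))(h, k) (`inner_hessian_action`). Thus K(c) is
controlled by C times the L² norms of h and k. The sine modes are orthogonal for both the H¹₀ and
the L² product, and the k-th one has the ratio (T/(kπ))² of squared L² norm to squared H¹₀ norm.
They are complete (`sineBasis`), so on the orthogonal complement of the first N modes the sharp
Wirtinger inequality `inner2_self_le` holds with constant (T/((N+1)π))². Hence the high-mode block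
of d²L(c) differs from the identity by at most κ = C(T/((N+1)π))² in norm, uniformly in c
(`norm_hessianBlock_sub_le`), and the condition on N says exactly that κ < 1.

The rest is abstract (`exists_reduction`). For fixed u, the map v ↦ v - Q∇L(u+v) is a κ-contraction,
which gives the unique ṽ(u); the block is invertible by a Neumann series, so the implicit function
theorem makes ṽ of class C¹ and gives its derivative. As Q∇L vanishes along u + ṽ(u), the gradient
of S is P∇L(u + ṽ(u)), which is C¹; differentiating it once more gives the Schur complement formula
for d²S. -/

theorem contDiff_gradient {f : E → ℝ} {n : ℕ} (hf : ContDiff ℝ (n + 1) f) :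
    ContDiff ℝ n (∇ f) :=
  (InnerProductSpace.toDual ℝ E).symm.contDiff.comp (hf.fderiv_right le_rfl)

theorem contDiff_of_hasGradientAt {f : E → ℝ} {g : E → E} {n : ℕ} (hg : ContDiff ℝ n g)
    (h : ∀ x, HasGradientAt f (g x) x) : ContDiff ℝ (n + 1) f :=
  contDiff_succ_iff_hasFDerivAt.2 ⟨fun x => InnerProductSpace.toDual ℝ E (g x),
    (InnerProductSpace.toDual ℝ E).contDiff.comp hg, fun x => (h x).hasFDerivAt⟩

theorem hasFDerivAt_gradient {f : E → ℝ} (hf : ContDiff ℝ 2 f) (x : E) :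
    HasFDerivAt (∇ f) (hessian f x) x :=
  ((contDiff_gradient (n := 1) hf).differentiable (by norm_num) x).hasFDerivAt

/-- The gradient is the Riesz representative of the derivative: pair with a fixed `k`, differentiate
both expressions, and use uniqueness of derivatives. -/
theorem inner_hessian {f : E → ℝ} (hf : ContDiff ℝ 2 f) (x h k : E) :
    inner ℝ (hessian f x h) k = fderiv ℝ (fderiv ℝ f) x h k := by
  have h1 : HasFDerivAt (fun y => inner ℝ (∇ f y) k) ((innerSL ℝ).flip k ∘L hessian f x) x :=
    ((innerSL ℝ).flip k).hasFDerivAt.comp x (hasFDerivAt_gradient hf x)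
  have h2 : (fun y => inner ℝ (∇ f y) k) = fun y => fderiv ℝ f y k := by
    funext y
    simp [gradient]
  have h3 : HasFDerivAt (fun y => fderiv ℝ f y k)
      ((ContinuousLinearMap.apply ℝ ℝ k) ∘L fderiv ℝ (fderiv ℝ f) x) x :=
    (ContinuousLinearMap.apply ℝ ℝ k).hasFDerivAt.comp x
      ((hf.fderiv_right (m := 1) (by norm_num)).differentiable one_ne_zero x).hasFDerivAt
  rw [h2] at h1
  exact congrArg (fun A => A h) (h1.unique h3)

/-- Neumann series for 1 - (1 - A). -/
theorem isInvertible_of_norm_sub_le {A : E →L[ℝ] E} {κ : ℝ} (hκ0 : 0 ≤ κ) (hκ : κ < 1)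
    (hA : ∀ v, ‖A v - v‖ ≤ κ * ‖v‖) : A.IsInvertible := by
  have h : ‖(1 : E →L[ℝ] E) - A‖ < 1 := by
    refine (ContinuousLinearMap.opNorm_le_bound _ hκ0 fun v => ?_).trans_lt hκ
    rw [_root_.sub_apply, norm_sub_rev]
    exact hA v
  have hu : IsUnit A := by simpa using isUnit_one_sub_of_norm_lt_one h
  obtain ⟨e, he⟩ := hu
  exact ⟨ContinuousLinearEquiv.unitsEquiv ℝ E e, by rw [← he]; rfl⟩

variable {U : Submodule ℝ E} [CompleteSpace U]

/-- A point of `U × Uᗮ` viewed as a point of the whole space. -/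
def sumCLM (U : Submodule ℝ E) : (U × Uᗮ) →L[ℝ] E := U.subtypeL.coprod Uᗮ.subtypeL

theorem contDiff_partialGradient (W : Submodule ℝ E) [W.HasOrthogonalProjection] {f : E → ℝ}
    (hf : ContDiff ℝ 2 f) : ContDiff ℝ 1 (partialGradient W f) :=
  (W.orthogonalProjectionOnto).contDiff.comp (contDiff_gradient (n := 1) hf)

theorem hasFDerivAt_partialGradient (W : Submodule ℝ E) [W.HasOrthogonalProjection] {f : E → ℝ}
    (hf : ContDiff ℝ 2 f) (x : E) :
    HasFDerivAt (partialGradient W f) (W.orthogonalProjectionOnto ∘L hessian f x) x :=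
  (W.orthogonalProjectionOnto).hasFDerivAt.comp x (hasFDerivAt_gradient hf x)

/-- Zeros are the fixed points of `Φ`, whose derivative is the identity minus the block and so has
norm at most κ. The mean value inequality makes `Φ` a contraction of the complete space `Uᗮ`. -/
theorem existsUnique_partialGradient_eq_zero {f : E → ℝ} (hf : ContDiff ℝ 2 f) {κ : ℝ}
    (hκ0 : 0 ≤ κ) (hκ : κ < 1) (hH : ∀ x v, ‖hessianBlock Uᗮ Uᗮ f x v - v‖ ≤ κ * ‖v‖) (u : U) :
    ∃! v : Uᗮ, partialGradient Uᗮ f ((u : E) + v) = 0 := by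
  let Φ : Uᗮ → Uᗮ := fun v => v - partialGradient Uᗮ f ((u : E) + v)
  have hΦ : ∀ v : Uᗮ, HasFDerivAt Φ (.id ℝ Uᗮ - hessianBlock Uᗮ Uᗮ f ((u : E) + v)) v := by
    intro v
    have h1 : HasFDerivAt (fun v : Uᗮ => (u : E) + v) Uᗮ.subtypeL v :=
      Uᗮ.subtypeL.hasFDerivAt.const_add _
    exact (hasFDerivAt_id v).sub ((hasFDerivAt_partialGradient Uᗮ hf _).comp v h1)
  have hlip : LipschitzWith ⟨κ, hκ0⟩ Φ := by
    refine LipschitzWith.of_dist_le_mul fun v v' => ?_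
    rw [dist_eq_norm, dist_eq_norm]
    refine convex_univ.norm_image_sub_le_of_norm_hasFDerivWithin_le
      (fun x _ => (hΦ x).hasFDerivWithinAt) (fun x _ => ?_) (mem_univ _) (mem_univ _)
    refine ContinuousLinearMap.opNorm_le_bound _ hκ0 fun k => ?_
    rw [_root_.sub_apply, norm_sub_rev]
    exact hH _ k
  have hc : ContractingWith ⟨κ, hκ0⟩ Φ := ⟨by exact_mod_cast hκ, hlip⟩
  have hiff : ∀ v : Uᗮ, Function.IsFixedPt Φ v ↔
      partialGradient Uᗮ f ((u : E) + v) = 0 := fun v => sub_eq_self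
  exact ⟨hc.fixedPoint, (hiff _).1 hc.fixedPoint_isFixedPt,
    fun v hv => hc.fixedPoint_unique ((hiff v).2 hv)⟩

theorem contDiffAt_and_hasFDerivAt_of_partialGradient_eq_zero_iff {f : E → ℝ}
    (hf : ContDiff ℝ 2 f) {w : U → Uᗮ}
    (hw : ∀ (u : U) (v : Uᗮ), partialGradient Uᗮ f ((u : E) + v) = 0 ↔ v = w u) (u : U)
    (hinv : (hessianBlock Uᗮ Uᗮ f ((u : E) + w u)).IsInvertible) :
    ContDiffAt ℝ 1 w u ∧ HasFDerivAt w (-((hessianBlock Uᗮ Uᗮ f ((u : E) + w u)).inverse ∘L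
      hessianBlock U Uᗮ f ((u : E) + w u))) u := by
  let F : U × Uᗮ → Uᗮ := fun p => partialGradient Uᗮ f (sumCLM U p)
  have hF : ContDiff ℝ 1 F := (contDiff_partialGradient Uᗮ hf).comp (sumCLM U).contDiff
  have hF' : fderiv ℝ F (u, w u) =
      Uᗮ.orthogonalProjectionOnto ∘L hessian f ((u : E) + w u) ∘L sumCLM U :=
    ((hasFDerivAt_partialGradient Uᗮ hf _).comp (u, w u) (sumCLM U).hasFDerivAt).fderiv
  have hr : fderiv ℝ F (u, w u) ∘L .inr ℝ U Uᗮ = hessianBlock Uᗮ Uᗮ f ((u : E) + w u) := by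
    rw [hF']
    ext v
    simp [hessianBlock, sumCLM]
  have hl : fderiv ℝ F (u, w u) ∘L .inl ℝ U Uᗮ = hessianBlock U Uᗮ f ((u : E) + w u) := by
    rw [hF']
    ext v
    simp [hessianBlock, sumCLM]
  have hF0 : F (u, w u) = 0 := (hw u (w u)).2 rfl
  have hi : (fderiv ℝ F (u, w u) ∘L .inr ℝ U Uᗮ).IsInvertible := hr ▸ hinv
  have hFa : ContDiffAt ℝ 1 F (u, w u) := hF.contDiffAt
  -- Global uniqueness of the zero forces `w` to agree with the local implicit function, so
  -- continuity of `w` need not be known beforehand.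
  have heq : w =ᶠ[nhds u] hFa.implicitFunction one_ne_zero hi := by
    filter_upwards [hFa.eventually_apply_implicitFunction one_ne_zero hi] with x hx
    rw [hF0] at hx
    exact ((hw x _).1 hx).symm
  refine ⟨(hFa.contDiffAt_implicitFunction one_ne_zero hi).congr_of_eventuallyEq heq, ?_⟩
  have h := (hFa.hasStrictFDerivAt_implicitFunction one_ne_zero hi).hasFDerivAt
  rw [hr, hl] at h
  exact h.congr_of_eventuallyEq heq

/-- In the chain rule the derivative of `w` takes values in `Uᗮ`, where the gradient has zero
component, so its contribution disappears. -/
theorem hasGradientAt_reduced {f : E → ℝ} (hf : ContDiff ℝ 2 f) {w : U → Uᗮ} {u : U}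
    (hw : DifferentiableAt ℝ w u) (h0 : partialGradient Uᗮ f ((u : E) + w u) = 0) :
    HasGradientAt (fun u : U => f ((u : E) + w u)) (partialGradient U f ((u : E) + w u)) u := by
  have h1 : HasFDerivAt (fun u : U => (u : E) + w u)
      (U.subtypeL + Uᗮ.subtypeL ∘L fderiv ℝ w u) u :=
    U.subtypeL.hasFDerivAt.add (Uᗮ.subtypeL.hasFDerivAt.comp u hw.hasFDerivAt)
  have h2 := ((hf.differentiable (by norm_num)
    ((u : E) + w u)).hasGradientAt.hasFDerivAt).comp u h1
  rw [hasGradientAt_iff_hasFDerivAt]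
  refine h2.congr_fderiv ?_
  ext h
  have h3 : inner ℝ (∇ f ((u : E) + w u)) ((fderiv ℝ w u h : Uᗮ) : E) = 0 := by
    rw [← Submodule.inner_orthogonalProjectionOnto_eq_of_mem_right]
    change inner ℝ (partialGradient Uᗮ f ((u : E) + w u)) _ = 0
    rw [h0, inner_zero_left]
  change inner ℝ (∇ f ((u : E) + w u)) ((h : E) + (fderiv ℝ w u h : Uᗮ)) =
    inner ℝ (partialGradient U f ((u : E) + w u)) h
  rw [inner_add_right, h3, add_zero]
  exact (Submodule.inner_orthogonalProjectionOnto_eq_of_mem_right h _).symm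

/-- Lyapunov–Schmidt reduction of a functional whose Hessian is uniformly close to the identity
on the orthogonal complement of `U`. -/
theorem exists_reduction {f : E → ℝ} (hf : ContDiff ℝ 2 f) {κ : ℝ} (hκ0 : 0 ≤ κ) (hκ : κ < 1)
    (hH : ∀ x v, ‖hessianBlock Uᗮ Uᗮ f x v - v‖ ≤ κ * ‖v‖) :
    ∃ w : U → Uᗮ, ContDiff ℝ 1 w ∧
      (∀ (u : U) (v : Uᗮ), partialGradient Uᗮ f ((u : E) + v) = 0 ↔ v = w u) ∧
      ContDiff ℝ 2 (fun u : U => f ((u : E) + w u)) ∧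
      ∀ (u : U) (c : E), c = (u : E) + w u →
        (hessianBlock Uᗮ Uᗮ f c).IsInvertible ∧
        HasGradientAt (fun u : U => f ((u : E) + w u)) (partialGradient U f c) u ∧
        HasFDerivAt w (-((hessianBlock Uᗮ Uᗮ f c).inverse ∘L hessianBlock U Uᗮ f c)) u ∧
        hessian (fun u : U => f ((u : E) + w u)) u =
          hessianBlock U U f c - hessianBlock Uᗮ U f c ∘L
            (hessianBlock Uᗮ Uᗮ f c).inverse ∘L hessianBlock U Uᗮ f c := by
  choose w hw0 hwu using existsUnique_partialGradient_eq_zero (U := U) hf hκ0 hκ hH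
  have hw : ∀ (u : U) (v : Uᗮ), partialGradient Uᗮ f ((u : E) + v) = 0 ↔ v = w u :=
    fun u v => ⟨hwu u v, fun h => h ▸ hw0 u⟩
  have hinv : ∀ x, (hessianBlock Uᗮ Uᗮ f x).IsInvertible :=
    fun x => isInvertible_of_norm_sub_le hκ0 hκ (hH x)
  have hd := fun u => contDiffAt_and_hasFDerivAt_of_partialGradient_eq_zero_iff hf hw u (hinv _)
  have hw1 : ContDiff ℝ 1 w := contDiff_iff_contDiffAt.2 fun u => (hd u).1
  have hgrad : ∀ u : U, HasGradientAt (fun u : U => f ((u : E) + w u))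
      (partialGradient U f ((u : E) + w u)) u :=
    fun u => hasGradientAt_reduced hf (hd u).2.differentiableAt (hw0 u)
  have hsum : ContDiff ℝ 1 fun u : U => (u : E) + w u :=
    U.subtypeL.contDiff.add (Uᗮ.subtypeL.contDiff.comp hw1)
  -- Although `w` is only C¹, the gradient of the reduced functional does not involve its
  -- derivative; it is therefore C¹, and the functional is C².
  refine ⟨w, hw1, hw, contDiff_of_hasGradientAt (n := 1)
    ((contDiff_partialGradient U hf).comp hsum) hgrad, ?_⟩
  rintro u c rfl
  refine ⟨hinv _, hgrad u, (hd u).2, ?_⟩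
  have h1 := U.subtypeL.hasFDerivAt.add (Uᗮ.subtypeL.hasFDerivAt.comp u (hd u).2)
  rw [hessian, gradient_eq hgrad]
  refine ((hasFDerivAt_partialGradient U hf _).comp u h1).fderiv.trans ?_
  ext h
  simp [hessianBlock, sub_eq_add_neg]

end Reduction

/-! ### Differentiation of integral functionals. -/

theorem hasFDerivAt_intervalIntegral_of_continuous {X F : Type*} [NormedAddCommGroup X]
    [NormedSpace ℝ X] [NormedAddCommGroup F] [NormedSpace ℝ F] {f : X → ℝ → F}
    {f' : X → ℝ → X →L[ℝ] F} (hf : Continuous f.uncurry) (hf' : Continuous f'.uncurry)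
    (h : ∀ x t, HasFDerivAt (fun x => f x t) (f' x t) x) (a b : ℝ) (x₀ : X) :
    HasFDerivAt (fun x => ∫ t in a..b, f x t) (∫ t in a..b, f' x₀ t) x₀ := by
  have hc : ∀ x, Continuous (f x) := fun x => hf.comp (Continuous.prodMk_right x)
  have hc' : ∀ x, Continuous (f' x) := fun x => hf'.comp (Continuous.prodMk_right x)
  -- Compactness of the interval turns joint continuity into one neighbourhood of `x₀` valid for all
  -- `t`, which supplies the dominating function.
  have hs : ∀ᶠ x in nhds x₀, ∀ t ∈ uIcc a b, ‖f' x t‖ < ‖f' x₀ t‖ + 1 := by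
    refine isCompact_uIcc.eventually_forall_of_forall_eventually fun t _ => ?_
    have h1 : Continuous fun z : X × ℝ => ‖f' z.1 z.2‖ := hf'.norm
    have h2 : Continuous fun z : X × ℝ => ‖f' x₀ z.2‖ + 1 := by fun_prop
    exact h1.continuousAt.eventually_lt h2.continuousAt (lt_add_one _)
  refine intervalIntegral.hasFDerivAt_integral_of_dominated_of_fderiv_le
    (bound := fun t => ‖f' x₀ t‖ + 1) hs
    (.of_forall fun x => (hc x).aestronglyMeasurable) ((hc x₀).intervalIntegrable _ _)
    (hc' x₀).aestronglyMeasurable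
    (.of_forall fun t ht x hx => (hx t (uIoc_subset_uIcc ht)).le)
    (Continuous.intervalIntegrable (by fun_prop) _ _)
    (.of_forall fun t _ x _ => h x t)

section Potential

variable {X E : Type*} [NormedAddCommGroup X] [NormedSpace ℝ X] [NormedAddCommGroup E]
  [NormedSpace ℝ E] {V : E → ℝ} {q : ℝ → E} {ev : ℝ → X →L[ℝ] E}

theorem hasFDerivAt_integral_potential (hV : ContDiff ℝ 1 V) (hq : Continuous q)
    (hev : Continuous ev) (a b : ℝ) (x : X) :
    HasFDerivAt (fun x => ∫ t in a..b, V (q t + ev t x))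
      (∫ t in a..b, fderiv ℝ V (q t + ev t x) ∘L ev t) x := by
  have hV' := hV.continuous_fderiv one_ne_zero
  have hVc := hV.continuous
  refine hasFDerivAt_intervalIntegral_of_continuous
    (f' := fun x t => fderiv ℝ V (q t + ev t x) ∘L ev t) ?_ ?_ (fun x t => ?_) a b x
  · simp only [Function.uncurry_def]
    fun_prop
  · simp only [Function.uncurry_def]
    fun_prop
  · exact ((hV.differentiable one_ne_zero) _).hasFDerivAt.comp x
      ((ev t).hasFDerivAt.const_add (q t))

/-- The second derivative in `x` of `V (q t + ev t x)`. -/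
def potentialSecondDeriv (V : E → ℝ) (q : ℝ → E) (ev : ℝ → X →L[ℝ] E) (x : X) (t : ℝ) :
    X →L[ℝ] X →L[ℝ] ℝ :=
  (ContinuousLinearMap.compL ℝ X E ℝ).flip (ev t) ∘L
    fderiv ℝ (fderiv ℝ V) (q t + ev t x) ∘L ev t

theorem continuous_potentialSecondDeriv (hV : ContDiff ℝ 2 V) (hq : Continuous q)
    (hev : Continuous ev) : Continuous (potentialSecondDeriv V q ev).uncurry := by
  have hV'' := (hV.fderiv_right (m := 1) (by norm_num)).continuous_fderiv one_ne_zero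
  simp only [Function.uncurry_def, potentialSecondDeriv]
  fun_prop

theorem hasFDerivAt_integral_fderiv_potential (hV : ContDiff ℝ 2 V) (hq : Continuous q)
    (hev : Continuous ev) (a b : ℝ) (x : X) :
    HasFDerivAt (fun x => ∫ t in a..b, fderiv ℝ V (q t + ev t x) ∘L ev t)
      (∫ t in a..b, potentialSecondDeriv V q ev x t) x := by
  have hV1 : ContDiff ℝ 1 (fderiv ℝ V) := hV.fderiv_right (by norm_num)
  have hV' := hV1.continuous
  refine hasFDerivAt_intervalIntegral_of_continuous ?_
    (continuous_potentialSecondDeriv hV hq hev) (fun x t => ?_) a b x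
  · simp only [Function.uncurry_def]
    fun_prop
  · exact ((ContinuousLinearMap.compL ℝ X E ℝ).flip (ev t)).hasFDerivAt.comp x
      (((hV1.differentiable one_ne_zero) _).hasFDerivAt.comp x
        ((ev t).hasFDerivAt.const_add (q t)))

end Potential

/-! ### Hölder continuity of H¹₀ curves and evaluation maps. -/

theorem continuous_clm_of_norm_sub_apply_le {X F : Type*} [NormedAddCommGroup X]
    [NormedSpace ℝ X] [NormedAddCommGroup F] [NormedSpace ℝ F] {A : ℝ → X →L[ℝ] F}
    (hA : ∀ s t x, ‖A t x - A s x‖ ≤ √|t - s| * ‖x‖) : Continuous A := by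
  refine continuous_iff_continuousAt.2 fun s => ?_
  rw [ContinuousAt, tendsto_iff_norm_sub_tendsto_zero]
  have h : Filter.Tendsto (fun t : ℝ => √|t - s|) (nhds s) (nhds 0) := by
    have : Continuous fun t : ℝ => √|t - s| := by fun_prop
    simpa using this.tendsto s
  refine squeeze_zero (fun t => norm_nonneg _) (fun t => ?_) h
  exact ContinuousLinearMap.opNorm_le_bound _ (by positivity) fun c => hA s t c

namespace H10

variable {T : ℝ} {n : ℕ}

theorem norm_eq_norm_velocity (c : H10 T n) : ‖c‖ = ‖velocity c‖ := rfl

theorem inner_eq_inner_velocity (c d : H10 T n) :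
    inner ℝ c d = inner ℝ (velocity c) (velocity d) := rfl

theorem curve_eq_zero (c : H10 T n) {t : ℝ} (ht : t ∉ Ioo 0 T) : c.curve t = 0 := c.2.2 t ht

theorem curve_sub (c : H10 T n) {s t : ℝ} (hs : s ∈ Icc 0 T) (ht : t ∈ Icc 0 T) :
    c.curve t - c.curve s = ∫ x in s..t, velocity c x := c.2.1 s hs t ht

theorem curve_add (c d : H10 T n) (t : ℝ) : (c + d).curve t = c.curve t + d.curve t := rfl

theorem curve_smul (a : ℝ) (c : H10 T n) (t : ℝ) : (a • c).curve t = a • c.curve t := rfl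

/-- Cauchy–Schwarz in L²: the squared norm of the increment `e` is the inner product of the velocity
with `e` times the indicator of (s, t], whose norm is √(t - s)‖e‖. -/
theorem norm_curve_sub_le_of_le (c : H10 T n) {s t : ℝ} (hs : 0 ≤ s) (hst : s ≤ t) (ht : t ≤ T) :
    ‖c.curve t - c.curve s‖ ≤ √(t - s) * ‖c‖ := by
  set e := c.curve t - c.curve s with he
  have h1 : e = ∫ x in Ioc s t, velocity c x ∂(volume.restrict (Ioc 0 T)) := by
    rw [he, curve_sub c ⟨hs, hst.trans ht⟩ ⟨hs.trans hst, ht⟩,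
      intervalIntegral.integral_of_le hst, Measure.restrict_restrict measurableSet_Ioc,
      inter_eq_left.2 (Ioc_subset_Ioc hs ht)]
  have h2 : ‖e‖ * ‖e‖ ≤ ‖e‖ * √(t - s) * ‖c‖ := by
    rw [← real_inner_self_eq_norm_mul_norm]
    nth_rewrite 2 [h1]
    rw [← L2.inner_indicatorConstLp_eq_inner_setIntegral ℝ measurableSet_Ioc
      (measure_ne_top (volume.restrict (Ioc 0 T)) (Ioc s t))]
    refine (real_inner_le_norm _ _).trans ?_
    rw [norm_eq_norm_velocity]
    gcongr
    refine norm_indicatorConstLp_le.trans_eq ?_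
    rw [measureReal_restrict_apply measurableSet_Ioc, inter_eq_left.2 (Ioc_subset_Ioc hs ht),
      Real.volume_real_Ioc_of_le hst, Real.sqrt_eq_rpow]
    norm_num
  rcases (norm_nonneg e).eq_or_lt with h0 | h0
  · rw [← h0]
    positivity
  · rw [mul_assoc] at h2
    exact le_of_mul_le_mul_left h2 h0

/-- The extension by zero is also the extension by endpoint values, so estimates on [0, T] pass to
all real times. -/
theorem curve_projIcc (hT : 0 ≤ T) (c : H10 T n) (t : ℝ) :
    c.curve (projIcc 0 T hT t) = c.curve t := by
  by_cases ht : t ∈ Icc 0 T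
  · rw [projIcc_of_mem hT ht]
  · rw [curve_eq_zero c fun h => ht (Ioo_subset_Icc_self h)]
    rcases lt_or_ge t 0 with h | h
    · rw [projIcc_of_le_left hT h.le]
      exact curve_eq_zero c (by simp)
    · rw [projIcc_of_right_le hT (not_lt.1 fun h' => ht ⟨h, h'.le⟩)]
      exact curve_eq_zero c (by simp)

theorem norm_curve_sub_le (hT : 0 ≤ T) (c : H10 T n) (s t : ℝ) :
    ‖c.curve t - c.curve s‖ ≤ √|t - s| * ‖c‖ := by
  wlog h : s ≤ t generalizing s t
  · rw [norm_sub_rev, abs_sub_comm]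
    exact this t s (le_of_not_ge h)
  rw [← curve_projIcc hT c t, ← curve_projIcc hT c s]
  refine (norm_curve_sub_le_of_le c (projIcc 0 T hT s).2.1
    (monotone_projIcc hT h) (projIcc 0 T hT t).2.2).trans ?_
  gcongr
  exact (le_abs_self _).trans (abs_projIcc_sub_projIcc hT)

/-- Evaluation at time `t`, as a continuous linear map. -/
def eval (T : ℝ) (n : ℕ) (t : ℝ) : H10 T n →L[ℝ] Conf n :=
  LinearMap.mkContinuous
    { toFun := fun c => c.curve t
      map_add' := fun c d => curve_add c d t
      map_smul' := fun a c => curve_smul a c t } √t <| by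
    intro c
    change ‖c.curve t‖ ≤ _
    by_cases ht : t ∈ Ioo 0 T
    · have h := norm_curve_sub_le_of_le c le_rfl ht.1.le ht.2.le
      rwa [curve_eq_zero c (t := 0) (by simp), sub_zero, sub_zero] at h
    · rw [curve_eq_zero c ht, norm_zero]
      positivity

@[simp]
theorem eval_apply (t : ℝ) (c : H10 T n) : eval T n t c = c.curve t := rfl

/-- The Hölder bound is uniform on the unit ball, so the continuity is in operator norm, as
differentiation under the integral requires. -/
theorem continuous_eval (hT : 0 ≤ T) : Continuous (eval T n) :=
  continuous_clm_of_norm_sub_apply_le fun s t c => norm_curve_sub_le hT c s t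

theorem continuous_curve (hT : 0 ≤ T) (c : H10 T n) : Continuous c.curve :=
  (continuous_eval hT).clm_apply continuous_const

/-- The derivative map `H¹₀ → L²` as a continuous linear map. -/
def velocityL (T : ℝ) (n : ℕ) : H10 T n →L[ℝ] L2 T n :=
  velocity.mkContinuous 1 fun c => by rw [one_mul, norm_eq_norm_velocity]

end H10

/-! ### The action functional: smoothness and Hessian. -/

open H10

variable {n : ℕ} {T : ℝ}

theorem integral_norm_sq_L2 (g : L2 T n) : ∫ t in Ioc 0 T, ‖g t‖ ^ 2 = ‖g‖ ^ 2 := by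
  rw [← real_inner_self_eq_norm_sq g, L2.inner_def]
  exact integral_congr_ae (.of_forall fun t => (real_inner_self_eq_norm_sq (g t)).symm)

/-- The segment from `q₀` to `q_T`. -/
def segmentCurve (T : ℝ) (q₀ qT : Conf n) (t : ℝ) : Conf n := q₀ + (t / T) • (qT - q₀)

theorem continuous_segmentCurve (T : ℝ) (q₀ qT : Conf n) : Continuous (segmentCurve T q₀ qT) := by
  unfold segmentCurve
  fun_prop

/-- Puts the action in the form of a quadratic term in L² minus a potential term, to which the
abstract derivative computations apply. -/
theorem action_eq {V : Conf n → ℝ} (hV : Continuous V) (hT : 0 ≤ T) (q₀ qT : Conf n)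
    (c : H10 T n) : action V q₀ qT c =
      1 / 2 * ‖Lp.const 2 (volume.restrict (Ioc 0 T)) ((1 / T) • (qT - q₀)) + velocityL T n c‖ ^ 2 -
        ∫ t in (0 : ℝ)..T, V (segmentCurve T q₀ qT t + eval T n t c) := by
  set e := (1 / T) • (qT - q₀) with he
  set g : L2 T n := Lp.const 2 (volume.restrict (Ioc 0 T)) e + velocityL T n c with hg
  have hae : (fun t => iotaVelocity q₀ qT c t) =ᵐ[volume.restrict (Ioc 0 T)] g := by
    filter_upwards [Lp.coeFn_add (Lp.const 2 (volume.restrict (Ioc 0 T)) e) (velocityL T n c),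
      Lp.coeFn_const (p := 2) (μ := volume.restrict (Ioc 0 T)) e] with t h1 h2
    rw [h1, Pi.add_apply, h2]
    rfl
  have hc := continuous_curve hT c
  have hs := continuous_segmentCurve T q₀ qT
  rw [action, curveAction]
  have h1 : ∫ t in (0 : ℝ)..T, lagrangian V (iota q₀ qT c t) (iotaVelocity q₀ qT c t) =
      ∫ t in (0 : ℝ)..T, (1 / 2 * ‖g t‖ ^ 2 - V (segmentCurve T q₀ qT t + eval T n t c)) := by
    rw [intervalIntegral.integral_of_le hT, intervalIntegral.integral_of_le hT]
    refine integral_congr_ae ?_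
    filter_upwards [hae] with t ht
    rw [← ht]
    rfl
  rw [h1, intervalIntegral.integral_sub, intervalIntegral.integral_const_mul,
    intervalIntegral.integral_of_le hT, integral_norm_sq_L2]
  · refine IntervalIntegrable.const_mul ?_ _
    rw [intervalIntegrable_iff_integrableOn_Ioc_of_le hT]
    exact (Lp.memLp g).integrable_norm_pow (by norm_num)
  · refine Continuous.intervalIntegrable ?_ _ _
    simp only [eval_apply]
    fun_prop

theorem hasFDerivAt_half_norm_sq {X F : Type*} [NormedAddCommGroup X] [NormedSpace ℝ X]
    [NormedAddCommGroup F] [InnerProductSpace ℝ F] (A : X →L[ℝ] F) (e : F) (x : X) :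
    HasFDerivAt (fun x => 1 / 2 * ‖e + A x‖ ^ 2) (innerSL ℝ (e + A x) ∘L A) x := by
  have h := ((A.hasFDerivAt (x := x)).const_add e).norm_sq.const_mul (1 / 2 : ℝ)
  refine h.congr_fderiv ?_
  ext y
  simp

theorem hasFDerivAt_innerSL_comp {X F : Type*} [NormedAddCommGroup X] [NormedSpace ℝ X]
    [NormedAddCommGroup F] [InnerProductSpace ℝ F] (A : X →L[ℝ] F) (e : F) (x : X) :
    HasFDerivAt (fun x => innerSL ℝ (e + A x) ∘L A)
      ((ContinuousLinearMap.compL ℝ X F ℝ).flip A ∘L innerSL ℝ ∘L A) x :=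
  ((ContinuousLinearMap.compL ℝ X F ℝ).flip A).hasFDerivAt.comp x
    ((innerSL ℝ).hasFDerivAt.comp x ((A.hasFDerivAt (x := x)).const_add e))

section SecondDerivative

variable {X F E : Type*} [NormedAddCommGroup X] [NormedSpace ℝ X] [NormedAddCommGroup F]
  [InnerProductSpace ℝ F] [NormedAddCommGroup E] [NormedSpace ℝ E] {V : E → ℝ} {q : ℝ → E}
  {ev : ℝ → X →L[ℝ] E}

/-- The second derivative of `x ↦ ½ ‖e + A x‖² - ∫ V (q t + ev t x)`. -/
def energySecondDeriv (A : X →L[ℝ] F) (V : E → ℝ) (q : ℝ → E) (ev : ℝ → X →L[ℝ] E) (a b : ℝ)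
    (x : X) : X →L[ℝ] X →L[ℝ] ℝ :=
  (ContinuousLinearMap.compL ℝ X F ℝ).flip A ∘L innerSL ℝ ∘L A -
    ∫ t in a..b, potentialSecondDeriv V q ev x t

set_option maxSynthPendingDepth 3 in
theorem contDiff_energy_and_fderiv_fderiv (A : X →L[ℝ] F) (e : F) (hV : ContDiff ℝ 2 V)
    (hq : Continuous q) (hev : Continuous ev) (a b : ℝ) :
    ContDiff ℝ 2 (fun x => 1 / 2 * ‖e + A x‖ ^ 2 - ∫ t in a..b, V (q t + ev t x)) ∧
    ∀ x, fderiv ℝ (fderiv ℝ fun x => 1 / 2 * ‖e + A x‖ ^ 2 - ∫ t in a..b, V (q t + ev t x)) x =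
      energySecondDeriv A V q ev a b x := by
  have hV1 : ContDiff ℝ 1 V := hV.of_le (by norm_num)
  have h1 := fun x => (hasFDerivAt_half_norm_sq A e x).sub
    (hasFDerivAt_integral_potential hV1 hq hev a b x)
  have hfd := funext fun x => (h1 x).fderiv
  have h2 := fun x => (hasFDerivAt_innerSL_comp A e x).sub
    (hasFDerivAt_integral_fderiv_potential hV hq hev a b x)
  have hc : Continuous (energySecondDeriv A V q ev a b) := by
    have h := intervalIntegral.continuous_parametric_intervalIntegral_of_continuous'
      (μ := volume) (continuous_potentialSecondDeriv hV hq hev) a b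
    exact continuous_const.sub h
  exact ⟨contDiff_succ_iff_hasFDerivAt (n := 1).2
    ⟨_, contDiff_one_iff_hasFDerivAt.2 ⟨_, hc, h2⟩, h1⟩,
    fun x => (congrArg (fun g => fderiv ℝ g x) hfd).trans (h2 x).fderiv⟩

set_option maxSynthPendingDepth 3 in
theorem energySecondDeriv_apply (A : X →L[ℝ] F) (hV : ContDiff ℝ 2 V) (hq : Continuous q)
    (hev : Continuous ev) (a b : ℝ) (x h k : X) :
    energySecondDeriv A V q ev a b x h k = inner ℝ (A h) (A k) -
      ∫ t in a..b, fderiv ℝ (fderiv ℝ V) (q t + ev t x) (ev t h) (ev t k) := by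
  have hi : IntervalIntegrable (potentialSecondDeriv V q ev x) volume a b :=
    ((continuous_potentialSecondDeriv hV hq hev).comp
      (Continuous.prodMk_right x)).intervalIntegrable a b
  have h1 : (∫ t in a..b, potentialSecondDeriv V q ev x t) h k =
      ∫ t in a..b, potentialSecondDeriv V q ev x t h k :=
    (((ContinuousLinearMap.apply ℝ ℝ k) ∘L
      (ContinuousLinearMap.apply ℝ (X →L[ℝ] ℝ) h)).intervalIntegral_comp_comm hi).symm
  rw [energySecondDeriv]
  simp only [_root_.sub_apply]
  rw [h1]
  rfl

end SecondDerivative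

section Action

variable {V : Conf n → ℝ}

theorem contDiff_action (hV : ContDiff ℝ 2 V) (hT : 0 ≤ T) (q₀ qT : Conf n) :
    ContDiff ℝ 2 (action V q₀ qT : H10 T n → ℝ) := by
  rw [show (action V q₀ qT : H10 T n → ℝ) = _ from funext (action_eq hV.continuous hT q₀ qT)]
  exact (contDiff_energy_and_fderiv_fderiv _ _ hV (continuous_segmentCurve T q₀ qT)
    (continuous_eval hT) 0 T).1

theorem inner_hessian_action (hV : ContDiff ℝ 2 V) (hT : 0 ≤ T) (q₀ qT : Conf n)
    (c h k : H10 T n) : inner ℝ (hessian (action V q₀ qT) c h) k = inner ℝ h k -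
      ∫ t in (0 : ℝ)..T, fderiv ℝ (fderiv ℝ V) (segmentCurve T q₀ qT t + c.curve t)
        (h.curve t) (k.curve t) := by
  have hq := continuous_segmentCurve T q₀ qT
  have hev : Continuous (eval T n) := continuous_eval hT
  rw [inner_hessian (contDiff_action hV hT q₀ qT),
    show (action V q₀ qT : H10 T n → ℝ) = _ from funext (action_eq hV.continuous hT q₀ qT),
    (contDiff_energy_and_fderiv_fderiv _ _ hV hq hev 0 T).2 c,
    energySecondDeriv_apply _ hV hq hev]
  rfl

end Action

/-! ### Orthogonality and completeness of the cosines on [0, T]. -/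

section CosineSystem

variable {T : ℝ}

theorem integral_cos_int_mul (hT : 0 < T) (m : ℤ) :
    ∫ t in (0 : ℝ)..T, Real.cos (m * Real.pi / T * t) = if m = 0 then T else 0 := by
  split_ifs with hm
  · simp [hm]
  · have hc : (m * Real.pi / T : ℝ) ≠ 0 := by
      have : (m : ℝ) ≠ 0 := by exact_mod_cast hm
      positivity
    rw [intervalIntegral.integral_comp_mul_left _ hc, integral_cos, mul_zero, Real.sin_zero,
      div_mul_cancel₀ _ hT.ne', Real.sin_int_mul_pi]
    simp

theorem integral_cos_mul_cos_and_sin_mul_sin (hT : 0 < T) {k l : ℕ} (hk : k ≠ 0) :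
    ∫ t in (0 : ℝ)..T, Real.cos (k * Real.pi / T * t) * Real.cos (l * Real.pi / T * t) =
      (if k = l then T / 2 else 0) ∧
    ∫ t in (0 : ℝ)..T, Real.sin (k * Real.pi / T * t) * Real.sin (l * Real.pi / T * t) =
      (if k = l then T / 2 else 0) := by
  have hsub := integral_cos_int_mul hT ((k : ℤ) - l)
  have hadd := integral_cos_int_mul hT ((k : ℤ) + l)
  -- Since `k` is nonzero and `l` is natural, `k + l` cannot vanish.
  rw [if_neg (by omega)] at hadd
  have hi : ∀ m : ℤ, IntervalIntegrable (fun t => Real.cos (m * Real.pi / T * t)) volume 0 T :=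
    fun m => Continuous.intervalIntegrable (by fun_prop) _ _
  have hif : (if (k : ℤ) - l = 0 then T else 0) / 2 = if k = l then T / 2 else 0 := by
    have : (k : ℤ) - l = 0 ↔ k = l := by omega
    simp only [this]
    split_ifs <;> simp
  have h1 : ∀ t : ℝ, ((((k : ℤ) - l : ℤ) : ℝ) * Real.pi / T * t) =
      k * Real.pi / T * t - l * Real.pi / T * t := fun t => by push_cast; ring
  have h2 : ∀ t : ℝ, ((((k : ℤ) + l : ℤ) : ℝ) * Real.pi / T * t) =
      k * Real.pi / T * t + l * Real.pi / T * t := fun t => by push_cast; ring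
  constructor
  · have hplus := intervalIntegral.integral_add (hi (k - l)) (hi (k + l))
    rw [hsub, hadd, add_zero] at hplus
    rw [← hif, ← hplus, ← intervalIntegral.integral_div]
    refine intervalIntegral.integral_congr fun t _ => ?_
    simp only [h1, h2, Real.cos_sub, Real.cos_add]
    ring
  · have hminus := intervalIntegral.integral_sub (hi (k - l)) (hi (k + l))
    rw [hsub, hadd, sub_zero] at hminus
    rw [← hif, ← hminus, ← intervalIntegral.integral_div]
    refine intervalIntegral.integral_congr fun t _ => ?_
    simp only [h1, h2, Real.cos_sub, Real.cos_add]
    ring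

theorem integrable_continuous_mul {f φ : ℝ → ℝ} (hf : IntegrableOn f (Ioc 0 T))
    (hφ : Continuous φ) : IntegrableOn (fun t => φ t * f t) (Ioc 0 T) := by
  obtain ⟨B, hB⟩ := (isCompact_Icc (a := 0) (b := T)).exists_bound_of_continuousOn hφ.continuousOn
  refine Integrable.bdd_mul (c := B) hf hφ.aestronglyMeasurable ?_
  filter_upwards [ae_restrict_mem measurableSet_Ioc] with t ht using hB t (Ioc_subset_Icc_self ht)

/-- Induction on `m` through 2 cos θ cos((k+1)θ) = cos((k+2)θ) + cos(kθ); for `k = 0` the extra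
cosine is simply moved out of the power. -/
theorem integral_cos_pow_mul_cos_mul_eq_zero {f : ℝ → ℝ} (hf : IntegrableOn f (Ioc 0 T))
    (h : ∀ k : ℕ, ∫ t in Ioc 0 T, Real.cos (k * Real.pi / T * t) * f t = 0) (m k : ℕ) :
    ∫ t in Ioc 0 T, Real.cos (Real.pi / T * t) ^ m * Real.cos (k * Real.pi / T * t) * f t = 0 := by
  induction m generalizing k with
  | zero => simpa using h k
  | succ m ih =>
    rcases k with _ | k
    · convert! ih 1 using 3 with t
      simp [pow_succ]
    · have h1 : ∀ l : ℕ, IntegrableOn (fun t => Real.cos (Real.pi / T * t) ^ m *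
          Real.cos (l * Real.pi / T * t) * f t) (Ioc 0 T) :=
        fun l => integrable_continuous_mul hf (by fun_prop)
      have h2 := integral_add (h1 (k + 2)) (h1 k)
      rw [ih, ih, add_zero] at h2
      have h3 : ∀ t, Real.cos (Real.pi / T * t) ^ (m + 1) *
          Real.cos ((k + 1 : ℕ) * Real.pi / T * t) * f t =
          (Real.cos (Real.pi / T * t) ^ m * Real.cos ((k + 2 : ℕ) * Real.pi / T * t) * f t +
          Real.cos (Real.pi / T * t) ^ m * Real.cos (k * Real.pi / T * t) * f t) / 2 := by
        intro t
        rw [show ((k + 2 : ℕ) * Real.pi / T * t : ℝ) =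
            (k + 1 : ℕ) * Real.pi / T * t + Real.pi / T * t by push_cast; ring,
          show (k * Real.pi / T * t : ℝ) =
            (k + 1 : ℕ) * Real.pi / T * t - Real.pi / T * t by push_cast; ring,
          Real.cos_add, Real.cos_sub]
        ring
      simp only [h3]
      rw [integral_div, h2, zero_div]

theorem integral_polynomial_cos_mul_eq_zero {f : ℝ → ℝ} (hf : IntegrableOn f (Ioc 0 T))
    (h : ∀ k : ℕ, ∫ t in Ioc 0 T, Real.cos (k * Real.pi / T * t) * f t = 0)
    (p : Polynomial ℝ) : ∫ t in Ioc 0 T, p.eval (Real.cos (Real.pi / T * t)) * f t = 0 := by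
  induction p using Polynomial.induction_on' with
  | add p q hp hq =>
    simp only [Polynomial.eval_add, add_mul]
    rw [integral_add (integrable_continuous_mul hf (by fun_prop))
      (integrable_continuous_mul hf (by fun_prop)), hp, hq, add_zero]
  | monomial m a =>
    simp only [Polynomial.eval_monomial, mul_assoc]
    rw [integral_const_mul]
    simpa using Or.inr (integral_cos_pow_mul_cos_mul_eq_zero hf h m 0)

theorem integral_continuous_mul_eq_zero (hT : 0 < T) {f : ℝ → ℝ} (hf : IntegrableOn f (Ioc 0 T))
    (h : ∀ k : ℕ, ∫ t in Ioc 0 T, Real.cos (k * Real.pi / T * t) * f t = 0)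
    {φ : ℝ → ℝ} (hφ : Continuous φ) : ∫ t in Ioc 0 T, φ t * f t = 0 := by
  have hbound : ∀ ε > 0, |∫ t in Ioc 0 T, φ t * f t| ≤ ε * ∫ t in Ioc 0 T, |f t| := by
    intro ε hε
    -- The substitution y = cos(πt/T) is a bijection of [0, T] onto [-1, 1], so Weierstrass
    -- approximation in `y` approximates φ uniformly by polynomials in the cosine.
    obtain ⟨p, hp⟩ := exists_polynomial_near_of_continuousOn (-1) 1
      (fun y => φ (T / Real.pi * Real.arccos y)) (by fun_prop) ε hε
    have h1 : ∀ t ∈ Ioc 0 T, |φ t - p.eval (Real.cos (Real.pi / T * t))| ≤ ε := by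
      intro t ht
      have h2 := hp (Real.cos (Real.pi / T * t)) (Real.cos_mem_Icc _)
      have h3 : Real.pi / T * t ≤ Real.pi := by
        rw [div_mul_eq_mul_div, div_le_iff₀ hT]
        exact mul_le_mul_of_nonneg_left ht.2 Real.pi_pos.le
      have ht0 := ht.1
      rw [Real.arccos_cos (by positivity) h3, ← mul_assoc,
        div_mul_div_cancel₀ Real.pi_pos.ne', div_self hT.ne', one_mul, abs_sub_comm] at h2
      exact h2.le
    calc |∫ t in Ioc 0 T, φ t * f t|
        = |∫ t in Ioc 0 T, (φ t * f t - p.eval (Real.cos (Real.pi / T * t)) * f t)| := by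
          rw [integral_sub (integrable_continuous_mul hf hφ)
            (integrable_continuous_mul hf (by fun_prop)),
            integral_polynomial_cos_mul_eq_zero hf h, sub_zero]
      _ ≤ ∫ t in Ioc 0 T, ε * |f t| := by
          rw [← Real.norm_eq_abs]
          refine norm_integral_le_of_norm_le (hf.abs.const_mul ε) ?_
          filter_upwards [ae_restrict_mem measurableSet_Ioc] with t ht
          rw [← sub_mul, norm_mul, Real.norm_eq_abs, Real.norm_eq_abs]
          exact mul_le_mul_of_nonneg_right (h1 t ht) (abs_nonneg _)
      _ = ε * ∫ t in Ioc 0 T, |f t| := integral_const_mul _ _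
  rw [← abs_nonpos_iff]
  have hlim : Filter.Tendsto (fun ε : ℝ => ε * ∫ t in Ioc 0 T, |f t|)
      (nhdsWithin 0 (Ioi 0)) (nhds 0) := by
    have : Continuous fun ε : ℝ => ε * ∫ t in Ioc 0 T, |f t| := by fun_prop
    simpa using (this.tendsto 0).mono_left nhdsWithin_le_nhds
  exact ge_of_tendsto hlim (by filter_upwards [self_mem_nhdsWithin] with ε hε using hbound ε hε)

theorem ae_eq_zero_of_integral_cos_mul_eq_zero (hT : 0 < T) {f : ℝ → ℝ}
    (hf : IntegrableOn f (Ioc 0 T))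
    (h : ∀ k : ℕ, ∫ t in Ioc 0 T, Real.cos (k * Real.pi / T * t) * f t = 0) :
    ∀ᵐ t ∂(volume.restrict (Ioc 0 T)), f t = 0 :=
  ae_eq_zero_of_integral_contDiff_smul_eq_zero hf.locallyIntegrable
    fun _ hg _ => integral_continuous_mul_eq_zero hT hf h hg.continuous

end CosineSystem

/-! ### The L² product on H¹₀, the sine basis and the Wirtinger inequality. -/

section IntegralInner

variable {X E : Type*} [NormedAddCommGroup X] [NormedSpace ℝ X] [NormedAddCommGroup E]
  [InnerProductSpace ℝ E]

/-- The functional `x ↦ ∫ ⟨g t, ev t x⟩ dt`. -/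
def integralInner (g : ℝ → E) (ev : ℝ → X →L[ℝ] E) (a b : ℝ) : X →L[ℝ] ℝ :=
  ∫ t in a..b, innerSL ℝ (g t) ∘L ev t

theorem integralInner_apply {g : ℝ → E} {ev : ℝ → X →L[ℝ] E} (hg : Continuous g)
    (hev : Continuous ev) (a b : ℝ) (x : X) :
    integralInner g ev a b x = ∫ t in a..b, inner ℝ (g t) (ev t x) := by
  have hc : Continuous fun t => innerSL ℝ (g t) ∘L ev t := by fun_prop
  exact ((ContinuousLinearMap.apply ℝ ℝ x).intervalIntegral_comp_comm
    (hc.intervalIntegrable a b)).symm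

end IntegralInner

/-- The `L²` inner product of curves, as a functional of the second one. -/
def inner2 (h : H10 T n) : H10 T n →L[ℝ] ℝ := integralInner h.curve (eval T n) 0 T

theorem inner2_apply (hT : 0 ≤ T) (h k : H10 T n) :
    inner2 h k = ∫ t in (0 : ℝ)..T, inner ℝ (h.curve t) (k.curve t) :=
  integralInner_apply (continuous_curve hT h) (continuous_eval hT) 0 T k

theorem inner2_comm (hT : 0 ≤ T) (h k : H10 T n) : inner2 h k = inner2 k h := by
  rw [inner2_apply hT, inner2_apply hT]
  simp only [real_inner_comm]

theorem inner2_self (hT : 0 ≤ T) (h : H10 T n) :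
    inner2 h h = ∫ t in (0 : ℝ)..T, ‖h.curve t‖ ^ 2 := by
  rw [inner2_apply hT]
  simp only [real_inner_self_eq_norm_sq]

theorem velocity_sineMode_ae (k : ℕ) (j : Fin n) :
    velocity (sineMode T k j) =ᵐ[volume.restrict (Ioc 0 T)] fun t =>
      (√(2 / T) * (k * Real.pi / T * Real.cos (k * Real.pi / T * t))) •
        EuclideanSpace.single j (1 : ℝ) :=
  MemLp.coeFn_toLp (memLp_cos T √(2 / T) (k * Real.pi / T) (EuclideanSpace.single j (1 : ℝ)))

theorem curve_sineMode {t : ℝ} (ht : t ∈ Icc 0 T) (k : ℕ) (j : Fin n) :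
    (sineMode T k j).curve t =
      (√(2 / T) * Real.sin (k * Real.pi / T * t)) • EuclideanSpace.single j (1 : ℝ) :=
  indicator_of_mem ht fun t : ℝ =>
    (√(2 / T) * Real.sin (k * Real.pi / T * t)) • EuclideanSpace.single j (1 : ℝ)

theorem inner_sineMode (k : ℕ) (j : Fin n) (x : H10 T n) :
    inner ℝ (sineMode T k j) x = √(2 / T) * (k * Real.pi / T) *
      ∫ t in Ioc 0 T, Real.cos (k * Real.pi / T * t) * velocity x t j := by
  rw [inner_eq_inner_velocity, L2.inner_def, ← integral_const_mul]
  refine integral_congr_ae ?_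
  filter_upwards [velocity_sineMode_ae k j] with t ht
  rw [ht, real_inner_smul_left, EuclideanSpace.inner_single_left]
  simp only [map_one]
  ring

theorem inner_sineMode_sineMode (hT : 0 < T) {k : ℕ} (hk : k ≠ 0) (l : ℕ) (i j : Fin n) :
    inner ℝ (sineMode T k i) (sineMode T l j) =
      if k = l ∧ i = j then (k * Real.pi / T) ^ 2 else 0 := by
  have h1 : ∫ t in Ioc 0 T, Real.cos (k * Real.pi / T * t) * velocity (sineMode T l j) t i =
      ∫ t in Ioc 0 T, √(2 / T) * (l * Real.pi / T) * (if i = j then 1 else 0) *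
        (Real.cos (k * Real.pi / T * t) * Real.cos (l * Real.pi / T * t)) := by
    refine integral_congr_ae ?_
    filter_upwards [velocity_sineMode_ae l j] with t ht
    rw [ht]
    by_cases hij : i = j
    · simp [hij]
      ring
    · simp [hij]
  have hs : √(2 / T) * √(2 / T) = 2 / T := Real.mul_self_sqrt (by positivity)
  rw [inner_sineMode, h1, integral_const_mul, ← intervalIntegral.integral_of_le hT.le,
    (integral_cos_mul_cos_and_sin_mul_sin hT hk).1]
  by_cases hkl : k = l <;> by_cases hij : i = j <;> simp only [hkl, hij, if_true, if_false,
    and_true, and_false, mul_zero, zero_mul, mul_one]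
  calc _ = √(2 / T) * √(2 / T) * (l * Real.pi / T) ^ 2 * (T / 2) := by ring
    _ = _ := by
      rw [hs]
      field_simp

theorem inner2_sineMode_sineMode (hT : 0 < T) {k : ℕ} (hk : k ≠ 0) (l : ℕ) (i j : Fin n) :
    inner2 (sineMode T k i) (sineMode T l j) = if k = l ∧ i = j then 1 else 0 := by
  have h1 : ∫ t in (0 : ℝ)..T, inner ℝ ((sineMode T k i).curve t) ((sineMode T l j).curve t) =
      ∫ t in (0 : ℝ)..T, √(2 / T) * √(2 / T) * (if i = j then 1 else 0) *
        (Real.sin (k * Real.pi / T * t) * Real.sin (l * Real.pi / T * t)) := by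
    refine intervalIntegral.integral_congr fun t ht => ?_
    rw [uIcc_of_le hT.le] at ht
    simp only [curve_sineMode ht, real_inner_smul_left, real_inner_smul_right,
      EuclideanSpace.inner_single_left]
    by_cases hij : i = j
    · simp [hij]
      ring
    · simp [hij]
  rw [inner2_apply hT.le, h1, intervalIntegral.integral_const_mul,
    (integral_cos_mul_cos_and_sin_mul_sin hT hk).2, Real.mul_self_sqrt (by positivity)]
  by_cases hkl : k = l <;> by_cases hij : i = j <;> simp only [hkl, hij, if_true, if_false,
    and_true, and_false, mul_zero, zero_mul, mul_one]
  field_simp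

/-- Orthogonality to the sine modes kills every cosine coefficient of the velocity except the
constant one. That one vanishes because of the boundary conditions, so completeness of the cosines
applies to each component. -/
theorem eq_zero_of_inner_sineMode_eq_zero (hT : 0 < T) {x : H10 T n}
    (hx : ∀ (k : ℕ) (j : Fin n), inner ℝ (sineMode T (k + 1) j) x = 0) : x = 0 := by
  have hint : IntegrableOn (velocity x) (Ioc 0 T) := (Lp.memLp (velocity x)).integrable (by norm_num)
  have hj : ∀ j : Fin n, ∀ᵐ t ∂(volume.restrict (Ioc 0 T)), velocity x t j = 0 := by
    intro j
    let P : Conf n →L[ℝ] ℝ := EuclideanSpace.proj j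
    refine ae_eq_zero_of_integral_cos_mul_eq_zero hT (P.integrable_comp hint) fun k => ?_
    rcases k with _ | k
    · have h0 : ∫ t in Ioc 0 T, velocity x t = 0 := by
        have h1 : velocity x ∈ range (velocity : H10 T n →ₗ[ℝ] L2 T n) := ⟨x, rfl⟩
        rwa [range_velocity] at h1
      have h2 := P.integral_comp_comm hint
      rw [h0, map_zero] at h2
      simp only [Nat.cast_zero, zero_mul, zero_div, Real.cos_zero, one_mul]
      exact h2
    · have h := hx k j
      rw [inner_sineMode] at h
      refine (mul_eq_zero.1 h).resolve_left ?_
      positivity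
  have hv : velocity x = 0 := by
    rw [Lp.eq_zero_iff_ae_eq_zero]
    filter_upwards [ae_all_iff.2 hj] with t ht
    ext j
    exact ht j
  exact velocity_injective (hv.trans (map_zero velocity).symm)

/-- The normalized sine modes. -/
def unitMode (T : ℝ) (n : ℕ) (p : ℕ × Fin n) : H10 T n :=
  (T / ((p.1 + 1 : ℕ) * Real.pi)) • sineMode T (p.1 + 1) p.2

theorem orthonormal_unitMode (hT : 0 < T) : Orthonormal ℝ (unitMode T n) := by
  classical
  rw [orthonormal_iff_ite]
  rintro ⟨k, i⟩ ⟨l, j⟩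
  rw [unitMode, unitMode, real_inner_smul_left, real_inner_smul_right,
    inner_sineMode_sineMode hT k.add_one_ne_zero]
  simp only [add_left_inj, Prod.mk.injEq]
  split_ifs with h
  · rw [← h.1]
    field_simp
  · simp

/-- The normalized sine modes form a Hilbert basis of `H¹₀`. -/
def sineBasis (hT : 0 < T) : HilbertBasis (ℕ × Fin n) ℝ (H10 T n) :=
  HilbertBasis.mkOfOrthogonalEqBot (orthonormal_unitMode hT) <| by
    rw [Submodule.eq_bot_iff]
    intro x hx
    refine eq_zero_of_inner_sineMode_eq_zero hT fun k j => ?_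
    have h := Submodule.inner_right_of_mem_orthogonal
      (Submodule.subset_span (mem_range_self (f := unitMode T n) (k, j))) hx
    rw [unitMode, real_inner_smul_left] at h
    refine (mul_eq_zero.1 h).resolve_left ?_
    positivity

theorem sineBasis_apply (hT : 0 < T) (p : ℕ × Fin n) : sineBasis hT p = unitMode T n p := by
  simp [sineBasis]

/-- The basis diagonalizes the L² form relative to the H¹₀ product. Both sides are continuous
functionals of `x`, so it suffices to compare them on basis vectors. -/
theorem inner2_sineBasis (hT : 0 < T) (p : ℕ × Fin n) (x : H10 T n) :
    inner2 (sineBasis hT p) x =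
      (T / ((p.1 + 1 : ℕ) * Real.pi)) ^ 2 * inner ℝ (sineBasis hT p) x := by
  have hdense : Dense (Submodule.span ℝ (range (sineBasis (n := n) hT)) : Set (H10 T n)) :=
    Submodule.dense_iff_topologicalClosure_eq_top.2 (sineBasis hT).dense_span
  have h : inner2 (sineBasis hT p) =
      (T / ((p.1 + 1 : ℕ) * Real.pi)) ^ 2 • innerSL ℝ (sineBasis hT p) := by
    refine ContinuousLinearMap.ext_on hdense ?_
    rintro _ ⟨q, rfl⟩
    change inner2 (sineBasis hT p) (sineBasis hT q) =
      (T / ((p.1 + 1 : ℕ) * Real.pi)) ^ 2 * inner ℝ (sineBasis hT p) (sineBasis hT q)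
    rw [inner2_comm hT.le, sineBasis_apply, sineBasis_apply]
    rw [unitMode, unitMode, map_smul, inner2_comm hT.le, map_smul, real_inner_smul_left,
      real_inner_smul_right,
      inner2_sineMode_sineMode hT p.1.add_one_ne_zero,
      inner_sineMode_sineMode hT p.1.add_one_ne_zero]
    simp only [smul_eq_mul]
    split_ifs with hpq
    · rw [← hpq.1]
      field_simp
    · simp
  exact congrArg (fun A => A x) h

/-- The sharp Wirtinger inequality for curves orthogonal to the first `N` sine modes. -/
theorem inner2_self_le (hT : 0 < T) {N : ℕ} {x : H10 T n} (hx : x ∈ highModes T n N) :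
    inner2 x x ≤ (T / ((N + 1 : ℕ) * Real.pi)) ^ 2 * ‖x‖ ^ 2 := by
  have hs1 : HasSum (fun p => (T / ((p.1 + 1 : ℕ) * Real.pi)) ^ 2 *
      inner ℝ (sineBasis hT p) x ^ 2) (inner2 x x) := by
    have h := ((sineBasis hT).hasSum_repr x).mapL (inner2 x)
    refine h.congr_fun fun p => ?_
    rw [map_smul, (sineBasis hT).repr_apply_apply, inner2_comm hT.le, inner2_sineBasis,
      smul_eq_mul]
    ring
  have hs2 : HasSum (fun p => (T / ((N + 1 : ℕ) * Real.pi)) ^ 2 *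
      inner ℝ (sineBasis hT p) x ^ 2) ((T / ((N + 1 : ℕ) * Real.pi)) ^ 2 * ‖x‖ ^ 2) := by
    have h := ((sineBasis hT).hasSum_inner_mul_inner x x).mul_left
      ((T / ((N + 1 : ℕ) * Real.pi)) ^ 2)
    rw [real_inner_self_eq_norm_sq] at h
    refine h.congr_fun fun p => ?_
    rw [real_inner_comm (sineBasis hT p) x, sq (inner ℝ _ x)]
  refine hasSum_le (fun p => ?_) hs1 hs2
  -- Indices start at zero: `p.1 < N` labels the modes 1, …, N, whose coefficients vanish by
  -- orthogonality. For the others the eigenvalue is at most that of mode `N + 1`.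
  by_cases hp : p.1 < N
  · have h0 : inner ℝ (sineBasis hT p) x = 0 := by
      refine Submodule.inner_right_of_mem_orthogonal (K := lowModes T n N) ?_ hx
      rw [sineBasis_apply]
      exact Submodule.smul_mem _ _ (Submodule.subset_span ⟨(⟨p.1, hp⟩, p.2), rfl⟩)
    simp [h0]
  · have h1 : (N : ℝ) ≤ p.1 := by exact_mod_cast not_lt.1 hp
    push_cast
    gcongr

/-! ### The high-mode Hessian is uniformly close to the identity. -/

theorem integral_norm_mul_norm_le (hT : 0 < T) {N : ℕ} {x y : H10 T n}
    (hx : x ∈ highModes T n N) (hy : y ∈ highModes T n N) :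
    ∫ t in (0 : ℝ)..T, ‖x.curve t‖ * ‖y.curve t‖ ≤
      (T / ((N + 1 : ℕ) * Real.pi)) ^ 2 * (‖x‖ * ‖y‖) := by
  set l : ℝ := T / ((N + 1 : ℕ) * Real.pi) with hl
  have hl0 : 0 ≤ l := by positivity
  have hmem : ∀ z : H10 T n, MemLp (fun t => ‖z.curve t‖) (ENNReal.ofReal 2)
      (volume.restrict (Ioc 0 T)) := by
    intro z
    obtain ⟨B, hB⟩ := (isCompact_Icc (a := 0) (b := T)).exists_bound_of_continuousOn
      (continuous_curve hT.le z).norm.continuousOn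
    refine MemLp.of_bound (continuous_curve hT.le z).norm.aestronglyMeasurable B ?_
    filter_upwards [ae_restrict_mem measurableSet_Ioc] with t ht using
      hB t (Ioc_subset_Icc_self ht)
  have hsqrt : ∀ z ∈ highModes T n N,
      (∫ t in Ioc 0 T, ‖z.curve t‖ ^ (2 : ℝ)) ^ (1 / 2 : ℝ) ≤ l * ‖z‖ := by
    intro z hz
    have h := inner2_self_le hT hz
    rw [inner2_self hT.le, intervalIntegral.integral_of_le hT.le, ← mul_pow] at h
    simp only [Real.rpow_two]
    rw [← Real.sqrt_eq_rpow]
    exact Real.sqrt_le_iff.2 ⟨by positivity, h⟩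
  rw [intervalIntegral.integral_of_le hT.le]
  -- Cauchy–Schwarz, as Hölder with both exponents 2; each factor is then bounded by Wirtinger.
  refine (integral_mul_le_Lp_mul_Lq_of_nonneg (Real.holderConjugate_iff.2 (by norm_num))
    (.of_forall fun t => norm_nonneg _) (.of_forall fun t => norm_nonneg _)
    (hmem x) (hmem y)).trans ?_
  calc _ ≤ (l * ‖x‖) * (l * ‖y‖) :=
        mul_le_mul (hsqrt x hx) (hsqrt y hy) (by positivity) (by positivity)
    _ = _ := by ring

/-- The difference `e` is tested against itself: the kinetic part cancels, leaving the integral of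
V''(v, e). As `v` and `e` are both high modes, each contributes one factor T/((N+1)π). -/
theorem norm_hessianBlock_sub_le {V : Conf n → ℝ} (hV : ContDiff ℝ 2 V) {C : ℝ}
    (hC : ∀ q, ‖fderiv ℝ (fderiv ℝ V) q‖ ≤ C) (hT : 0 < T) (q₀ qT : Conf n) (N : ℕ)
    (c : H10 T n) (v : highModes T n N) :
    ‖hessianBlock (highModes T n N) (highModes T n N) (action V q₀ qT) c v - v‖ ≤
      C * (T / ((N + 1 : ℕ) * Real.pi)) ^ 2 * ‖v‖ := by
  set e := hessianBlock (highModes T n N) (highModes T n N) (action V q₀ qT) c v - v with he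
  have hC0 : 0 ≤ C := (ContinuousLinearMap.opNorm_nonneg _).trans (hC 0)
  have h1 : inner ℝ e e = -∫ t in (0 : ℝ)..T, fderiv ℝ (fderiv ℝ V)
      (segmentCurve T q₀ qT t + c.curve t) ((v : H10 T n).curve t) ((e : H10 T n).curve t) := by
    have h2 : inner ℝ (hessianBlock (highModes T n N) (highModes T n N) (action V q₀ qT) c v) e =
        inner ℝ (hessian (action V q₀ qT) c v) (e : H10 T n) :=
      Submodule.inner_orthogonalProjectionOnto_eq_of_mem_right e _
    nth_rewrite 1 [he]
    rw [inner_sub_left, h2, inner_hessian_action hV hT.le, Submodule.coe_inner]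
    ring
  have h2 : ‖e‖ * ‖e‖ ≤ C * (T / ((N + 1 : ℕ) * Real.pi)) ^ 2 * ‖v‖ * ‖e‖ := by
    rw [← real_inner_self_eq_norm_mul_norm, h1]
    refine (neg_le_abs _).trans ?_
    rw [← Real.norm_eq_abs]
    have hcv := continuous_curve hT.le (v : H10 T n)
    have hce := continuous_curve hT.le (e : H10 T n)
    calc _ ≤ ∫ t in (0 : ℝ)..T, C * (‖(v : H10 T n).curve t‖ * ‖(e : H10 T n).curve t‖) := by
          refine intervalIntegral.norm_integral_le_of_norm_le hT.le
            (.of_forall fun t _ => ?_) (Continuous.intervalIntegrable (by fun_prop) _ _)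
          rw [← mul_assoc]
          refine (ContinuousLinearMap.le_opNorm₂ _ _ _).trans ?_
          gcongr
          exact hC _
      _ ≤ C * ((T / ((N + 1 : ℕ) * Real.pi)) ^ 2 * (‖v‖ * ‖e‖)) := by
          rw [intervalIntegral.integral_const_mul]
          exact mul_le_mul_of_nonneg_left (integral_norm_mul_norm_le hT v.2 e.2) hC0
      _ = _ := by ring
  rcases (norm_nonneg e).eq_or_lt with h0 | h0
  · rw [← h0]
    positivity
  · exact le_of_mul_le_mul_right h2 h0

end ExactReduction

end

theorem proposition3 {n : ℕ} (V : Conf n → ℝ) (hV : ContDiff ℝ 2 V)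
    (C : ℝ) (hC : IsLUB (Set.range fun q : Conf n => ‖fderiv ℝ (fderiv ℝ V) q‖) C)
    (T : ℝ) (hT : 0 < T) (q₀ qT : Conf n)
    (N : ℕ) (hN : ⌊T * √C / Real.pi⌋ ≤ (N : ℤ)) :
    ContDiff ℝ 2 (action V q₀ qT : H10 T n → ℝ) ∧
    ∃ w : lowModes T n N → highModes T n N,
      ContDiff ℝ 1 w ∧
      (∀ (u : lowModes T n N) (v : highModes T n N),
        partialGradient (highModes T n N) (action V q₀ qT) ((u : H10 T n) + (v : H10 T n)) = 0
          ↔ v = w u) ∧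
      ContDiff ℝ 2 (reducedAction V q₀ qT w) ∧
      ∀ (u : lowModes T n N) (c : H10 T n), c = (u : H10 T n) + (w u : H10 T n) →
        (hessianBlock (highModes T n N) (highModes T n N) (action V q₀ qT) c).IsInvertible ∧
        HasGradientAt (reducedAction V q₀ qT w)
          (partialGradient (lowModes T n N) (action V q₀ qT) c) u ∧
        HasFDerivAt w
          (-((hessianBlock (highModes T n N) (highModes T n N) (action V q₀ qT) c).inverse ∘L
            hessianBlock (lowModes T n N) (highModes T n N) (action V q₀ qT) c)) u ∧
        hessian (reducedAction V q₀ qT w) u =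
          hessianBlock (lowModes T n N) (lowModes T n N) (action V q₀ qT) c -
            hessianBlock (highModes T n N) (lowModes T n N) (action V q₀ qT) c ∘L
              (hessianBlock (highModes T n N) (highModes T n N) (action V q₀ qT) c).inverse ∘L
                hessianBlock (lowModes T n N) (highModes T n N) (action V q₀ qT) c := by
  have hC' : ∀ q, ‖fderiv ℝ (fderiv ℝ V) q‖ ≤ C := fun q => hC.1 ⟨q, rfl⟩
  have hC0 : 0 ≤ C := (ContinuousLinearMap.opNorm_nonneg _).trans (hC' 0)
  -- The bound on the floor gives T√C/π < N + 1 strictly, and κ is the square of (T√C/π)/(N + 1).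
  have hκ : C * (T / ((N + 1 : ℕ) * Real.pi)) ^ 2 < 1 := by
    have h1 : T * √C / Real.pi < (N + 1 : ℕ) := by
      have h2 : ((⌊T * √C / Real.pi⌋ : ℤ) : ℝ) ≤ N := by exact_mod_cast hN
      have h3 := Int.lt_floor_add_one (T * √C / Real.pi)
      push_cast
      linarith
    have h4 : √C * (T / ((N + 1 : ℕ) * Real.pi)) < 1 := by
      rw [div_lt_iff₀ Real.pi_pos] at h1
      rw [← mul_div_assoc, div_lt_one (by positivity)]
      linarith
    have h5 : C * (T / ((N + 1 : ℕ) * Real.pi)) ^ 2 = (√C * (T / ((N + 1 : ℕ) * Real.pi))) ^ 2 := by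
      rw [mul_pow, Real.sq_sqrt hC0]
    rw [h5]
    exact pow_lt_one₀ (by positivity) h4 two_ne_zero
  have hL : ContDiff ℝ 2 (action V q₀ qT : H10 T n → ℝ) := contDiff_action hV hT.le q₀ qT
  exact ⟨hL, exists_reduction hL (by positivity) hκ
    (norm_hessianBlock_sub_le hV hC' hT q₀ qT N)⟩
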